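/- Let $\mathbb N=\{1,2,3,\dots\}$. For every countable limit ordinal $\xi$ fix an arbitrary strictly increasing sequence $(\xi_n)_{n\in\mathbb N}$ of ordinals smaller than $\xi$ with $\sup_n\xi_n=\xi$. The generalized Schreier families $\mathcal F_\xi$, $\xi<\omega_1$, of finite subsets of $\mathbb N$ (with the convention that $\emptyset$ belongs to each of them) are defined recursively as follows: $$\mathcal F_0=\{\emptyset\}\cup\{\{n\}:n\in\mathbb N\};$$ $\mathcal F_{\xi+1}$ consists of $\emptyset$ and all unions $\bigcup_{i=1}^n F_i$ where $n\in\mathbb N$, the sets $F_1,\dots,F_n\in\mathcal F_\xi$ are non-empty, and $n\le \min F_1$, $\max F_i<\min F_{i+1}$ for $1\le i<n$; and, for $\xi$ a limit ordinal, $\mathcal F_\xi$ consists of $\emptyset$ and all non-empty finite sets $F$ such that, for some $n\in\mathbb N$, $F\in\mathcal F_{\xi_n}$ and $n\le\min F$. For an infinite set $L=\{\ell_1<\ell_2<\cdots\}\subseteq\mathbb N$ put $\mathcal F_\xi(L)=\{\{\ell_{n_1},\dots,\ell_{n_k}\}:\{n_1,\dots,n_k\}\in\mathcal F_\xi\}$,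 and let $[L]^{<\omega}$ be the family of all finite subsets of $L$. A family $\mathcal F$ of finite subsets of $\mathbb N$ is hereditary if $t\subseteq s\in\mathcal F$ implies $t\in\mathcal F$. **Theorem.** For every hereditary family $\mathcal F$ of finite subsets of $\mathbb N$, every countable ordinal $\xi$ and every infinite $M\subseteq\mathbb N$ there exists an infinite $L\subseteq M$ such that either $\mathcal F_\xi(L)\subseteq\mathcal F$ or $\mathcal F\cap[L]^{<\omega}\subseteq\mathcal F_\xi$ (the two alternatives need not exclude each other). -/

import Mathlib

/-- A family of finite subsets of `{1, 2, 3, …}` is hereditary if it contains every subset of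
each of its members. -/
def IsHereditary (𝓕 : Set (Finset ℕ+)) : Prop :=
  ∀ s ∈ 𝓕, ∀ t : Finset ℕ+, t ⊆ s → t ∈ 𝓕

/-- `[L]^{<ω}`, the family of all finite subsets of `L`. -/
def finiteSubsets (L : Set ℕ+) : Set (Finset ℕ+) :=
  {s | (s : Set ℕ+) ⊆ L}

/-- A choice, for every countable limit ordinal `ξ`, of a strictly increasing sequence
`(ξ_n)_{n ≥ 1}` of ordinals smaller than `ξ` with supremum `ξ`. -/
def IsLimitChoice (σ : Ordinal.{0} → ℕ+ → Ordinal.{0}) : Prop :=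
  ∀ ξ : Ordinal.{0}, ξ < Ordinal.omega 1 → Order.IsSuccLimit ξ →
    StrictMono (σ ξ) ∧ (∀ n, σ ξ n < ξ) ∧ IsLUB (Set.range (σ ξ)) ξ

/-- The successor step: all unions `F_1 ∪ … ∪ F_n` with `n ≤ F_1 < … < F_n` and `F_i ∈ G`.
Some of the `F_i` may be empty; the inequalities are read elementwise, for all `i` and for all
pairs `i < j`, so that empty `F_i` only mean that fewer than `n` nonempty sets are used. -/
def schreierSucc (G : Set (Finset ℕ+)) : Set (Finset ℕ+) :=
  {s | ∃ (n : ℕ+) (F : Fin (n : ℕ) → Finset ℕ+),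
    (∀ i, F i ∈ G) ∧
    (∀ i, ∀ x ∈ F i, n ≤ x) ∧
    (∀ i j, i < j → ∀ x ∈ F i, ∀ y ∈ F j, x < y) ∧
    s = Finset.univ.biUnion F}

/-- The generalized Schreier families `𝓕_ξ` relative to a choice `σ` of sequences at limit
ordinals. The family `𝓕_0` consists of the empty set and all singletons. -/
noncomputable def schreier (σ : Ordinal.{0} → ℕ+ → Ordinal.{0}) (ξ : Ordinal.{0}) :
    Set (Finset ℕ+) :=
  Ordinal.limitRecOn (motive := fun _ => Set (Finset ℕ+)) ξ
    {s | s = ∅ ∨ ∃ n : ℕ+, s = {n}}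
    (fun _ G => schreierSucc G)
    (fun ξ _ G => {s | ∃ (n : ℕ+) (h : σ ξ n < ξ), s ∈ G (σ ξ n) h ∧ ∀ x ∈ s, n ≤ x})

theorem schreier_zero (σ : Ordinal.{0} → ℕ+ → Ordinal.{0}) :
    schreier σ 0 = {s | s = ∅ ∨ ∃ n : ℕ+, s = {n}} := by
  simp [schreier]

theorem schreier_succ (σ : Ordinal.{0} → ℕ+ → Ordinal.{0}) (ξ : Ordinal.{0}) :
    schreier σ (ξ + 1) = schreierSucc (schreier σ ξ) := by
  simp [schreier]

theorem schreier_limit (σ : Ordinal.{0} → ℕ+ → Ordinal.{0}) (hσ : IsLimitChoice σ)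
    (ξ : Ordinal.{0}) (hξ : ξ < Ordinal.omega 1) (hlim : Order.IsSuccLimit ξ) :
    schreier σ ξ = {s | ∃ n : ℕ+, s ∈ schreier σ (σ ξ n) ∧ ∀ x ∈ s, n ≤ x} := by
  have h := (hσ ξ hξ hlim).2.1
  ext s
  rw [schreier, Ordinal.limitRecOn_limit _ _ _ _ hlim]
  constructor
  · rintro ⟨n, _, h1, h2⟩
    exact ⟨n, h1, h2⟩
  · rintro ⟨n, h1, h2⟩
    exact ⟨n, h n, h1, h2⟩

/-- `G(L) = {{ℓ_{n_1}, …, ℓ_{n_k}} : {n_1, …, n_k} ∈ G}`, where `ℓ_1 < ℓ_2 < …` is the increasing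
enumeration of the infinite set `L`. -/
def transfer (G : Set (Finset ℕ+)) (L : Set ℕ+) : Set (Finset ℕ+) :=
  {s | ∃ ℓ : ℕ+ → ℕ+, StrictMono ℓ ∧ Set.range ℓ = L ∧ ∃ t ∈ G, s = t.image ℓ}

/-- Every infinite `L` has exactly one increasing enumeration. -/
theorem existsUnique_enumeration (L : Set ℕ+) (hL : L.Infinite) :
    ∃! ℓ : ℕ+ → ℕ+, StrictMono ℓ ∧ Set.range ℓ = L := by
  classical
  have e : ℕ+ ≃o ℕ := OrderIso.pnatIsoNat
  have hinf : (e '' L).Infinite := hL.image e.injective.injOn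
  have : Infinite (e '' L) := hinf.to_subtype
  obtain ⟨f, hf⟩ : ∃ f : ℕ ↪o ℕ, Set.range f = e '' L :=
    ⟨Nat.orderEmbeddingOfSet (e '' L), Nat.orderEmbeddingOfSet_range (e '' L)⟩
  have hmono : StrictMono fun n => e.symm (f (e n)) := by
    intro a b hab
    simpa using hab
  have hrange : Set.range (fun n => e.symm (f (e n))) = L := by
    ext x
    constructor
    · rintro ⟨n, rfl⟩
      obtain ⟨y, hy, h⟩ := hf.subset ⟨e n, rfl⟩
      simpa [← h] using hy
    · intro h
      obtain ⟨n, hn⟩ := hf.symm.subset ⟨x, h, rfl⟩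
      exact ⟨e.symm n, by simp [hn]⟩
  refine ⟨_, ⟨hmono, hrange⟩, ?_⟩
  rintro ℓ ⟨h1, h2⟩
  exact (h1.range_inj hmono).1 (h2.trans hrange.symm)

/-! Only three properties of `schreier σ ξ` matter: it is hereditary, precompact, and stable under
strictly increasing maps. The first two make its tree of end-extensions well-founded, so the
dichotomy can be proved at each node `s` from its one-point extensions (`exists_extensionsSubset`):
diagonalization settles all of them on one infinite set, and the pigeonhole principle makes the
outcome uniform. At the root `∅`, either the members of `schreier σ ξ` inside `L` lie in `𝓕`, or
conversely. Stability (`image_mem_schreier`) puts the transferred family among those members. -/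

theorem schreier_induction {σ : Ordinal.{0} → ℕ+ → Ordinal.{0}} (hσ : IsLimitChoice σ)
    {p : Set (Finset ℕ+) → Prop} (zero : p {s | s = ∅ ∨ ∃ n : ℕ+, s = {n}})
    (succ : ∀ G, p G → p (schreierSucc G))
    (limit : ∀ G : ℕ+ → Set (Finset ℕ+), (∀ n, p (G n)) →
      p {s | ∃ n : ℕ+, s ∈ G n ∧ ∀ x ∈ s, n ≤ x})
    (ξ : Ordinal.{0}) (hξ : ξ < Ordinal.omega 1) : p (schreier σ ξ) := by
  induction ξ using Ordinal.limitRecOn with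
  | zero => rw [schreier_zero]; exact zero
  | add_one ξ ih =>
    rw [schreier_succ]
    exact succ _ (ih ((lt_add_one ξ).trans hξ))
  | limit ξ hlim ih =>
    rw [schreier_limit σ hσ ξ hξ hlim]
    have h := (hσ ξ hξ hlim).2.1
    exact limit (fun n => schreier σ (σ ξ n)) fun n => ih _ (h n) ((h n).trans hξ)

theorem IsHereditary.schreierSucc {G : Set (Finset ℕ+)} (hG : IsHereditary G) :
    IsHereditary (schreierSucc G) := by
  rintro s ⟨n, F, hF, hn, hlt, rfl⟩ t ht
  refine ⟨n, fun i => F i ∩ t, fun i => hG _ (hF i) _ Finset.inter_subset_left,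
    fun i x hx => hn i x (Finset.mem_inter.1 hx).1,
    fun i j hij x hx y hy =>
      hlt i j hij x (Finset.mem_inter.1 hx).1 y (Finset.mem_inter.1 hy).1, ?_⟩
  ext x
  constructor
  · intro hx
    obtain ⟨i, -, hi⟩ := Finset.mem_biUnion.1 (ht hx)
    exact Finset.mem_biUnion.2 ⟨i, Finset.mem_univ _, Finset.mem_inter.2 ⟨hi, hx⟩⟩
  · intro hx
    obtain ⟨i, -, hi⟩ := Finset.mem_biUnion.1 hx
    exact (Finset.mem_inter.1 hi).2

theorem isHereditary_schreier {σ : Ordinal.{0} → ℕ+ → Ordinal.{0}} (hσ : IsLimitChoice σ)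
    (ξ : Ordinal.{0}) (hξ : ξ < Ordinal.omega 1) : IsHereditary (schreier σ ξ) := by
  refine schreier_induction hσ (p := IsHereditary) ?_ (fun G hG => hG.schreierSucc) ?_ ξ hξ
  · rintro s (rfl | ⟨n, rfl⟩) t ht
    · exact Or.inl (Finset.subset_empty.1 ht)
    · rcases Finset.subset_singleton_iff.1 ht with h | h
      · exact Or.inl h
      · exact Or.inr ⟨n, h⟩
  · rintro G hG s ⟨n, hs, hn⟩ t ht
    exact ⟨n, hG n s hs t ht, fun x hx => hn x (ht hx)⟩

theorem empty_mem_schreier {σ : Ordinal.{0} → ℕ+ → Ordinal.{0}} (hσ : IsLimitChoice σ)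
    (ξ : Ordinal.{0}) (hξ : ξ < Ordinal.omega 1) : ∅ ∈ schreier σ ξ := by
  refine schreier_induction hσ (p := fun G => ∅ ∈ G) (Or.inl rfl) (fun G hG => ?_)
    (fun G hG => ⟨1, hG 1, by simp⟩) ξ hξ
  exact ⟨1, fun _ => ∅, fun _ => hG, by simp, by simp, by ext; simp⟩

theorem image_mem_schreier {σ : Ordinal.{0} → ℕ+ → Ordinal.{0}} (hσ : IsLimitChoice σ)
    {ℓ : ℕ+ → ℕ+} (hℓ : StrictMono ℓ) (ξ : Ordinal.{0}) (hξ : ξ < Ordinal.omega 1) :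
    ∀ t ∈ schreier σ ξ, t.image ℓ ∈ schreier σ ξ := by
  refine schreier_induction hσ (p := fun G => ∀ t ∈ G, t.image ℓ ∈ G) ?_ ?_ ?_ ξ hξ
  · rintro t (rfl | ⟨n, rfl⟩)
    · exact Or.inl (by simp)
    · exact Or.inr ⟨ℓ n, by simp⟩
  · rintro G hG t ⟨n, F, hF, hn, hlt, rfl⟩
    refine ⟨n, fun i => (F i).image ℓ, fun i => hG _ (hF i), ?_, ?_, Finset.biUnion_image⟩
    · intro i x hx
      obtain ⟨y, hy, rfl⟩ := Finset.mem_image.1 hx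
      exact (hn i y hy).trans hℓ.le_apply
    · intro i j hij x hx y hy
      obtain ⟨x', hx', rfl⟩ := Finset.mem_image.1 hx
      obtain ⟨y', hy', rfl⟩ := Finset.mem_image.1 hy
      exact hℓ (hlt i j hij x' hx' y' hy')
  · rintro G hG t ⟨n, ht, hn⟩
    refine ⟨n, hG n t ht, fun x hx => ?_⟩
    obtain ⟨y, hy, rfl⟩ := Finset.mem_image.1 hx
    exact (hn y hy).trans hℓ.le_apply

/-! ### Precompactness and well-foundedness -/

theorem Set.Infinite.inter_Ioi {M : Set ℕ+} (hM : M.Infinite) (n : ℕ+) :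
    (M ∩ Set.Ioi n).Infinite := by
  refine (hM.sdiff (Set.finite_Iic n)).mono fun x hx => ⟨hx.1, ?_⟩
  simpa using hx.2

/-- Every infinite set has a finite subset outside `G`. -/
def IsPrecompact (G : Set (Finset ℕ+)) : Prop :=
  ∀ X : Set ℕ+, X.Infinite → ∃ K : Finset ℕ+, (K : Set ℕ+) ⊆ X ∧ K ∉ G

/-- Stack sets outside `G` one above another. The first block cannot cover the lowest, so a later
block meets it; the first block then lies below everything higher and is useless there. -/
theorem IsPrecompact.exists_not_subset_biUnion {G : Set (Finset ℕ+)} (hG : IsPrecompact G)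
    (hher : IsHereditary G) (n : ℕ) :
    ∀ X : Set ℕ+, X.Infinite → ∃ K : Finset ℕ+, (K : Set ℕ+) ⊆ X ∧
      ∀ F : Fin n → Finset ℕ+, (∀ i, F i ∈ G) →
        (∀ i j, i < j → ∀ x ∈ F i, ∀ y ∈ F j, x < y) → ¬ K ⊆ Finset.univ.biUnion F := by
  induction n with
  | zero =>
    intro X hX
    obtain ⟨x, hx⟩ := hX.nonempty
    exact ⟨{x}, by simpa using hx, fun F _ _ h => by simpa using h (Finset.mem_singleton_self x)⟩
  | succ n ih =>
    intro X hX
    obtain ⟨K, hKX, hK⟩ := hG X hX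
    obtain ⟨b, hb⟩ := K.bddAbove
    obtain ⟨K', hKX', hK'⟩ := ih _ (hX.inter_Ioi b)
    refine ⟨K ∪ K', ?_, fun F hF hlt hsub => ?_⟩
    · rw [Finset.coe_union]
      exact Set.union_subset hKX (hKX'.trans Set.inter_subset_left)
    have h0 : ¬ K ⊆ F 0 := fun h => hK (hher _ (hF 0) _ h)
    obtain ⟨x, hxK, hx0⟩ := Finset.not_subset.1 h0
    obtain ⟨i, -, hi⟩ := Finset.mem_biUnion.1 (hsub (Finset.mem_union_left _ hxK))
    have hi0 : 0 < i := Fin.pos_iff_ne_zero.2 fun h => hx0 (h ▸ hi)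
    refine hK' (fun j => F j.succ) (fun j => hF _)
      (fun j k hjk => hlt _ _ (Fin.succ_lt_succ_iff.2 hjk)) fun y hy => ?_
    obtain ⟨j, -, hj⟩ := Finset.mem_biUnion.1 (hsub (Finset.mem_union_right _ hy))
    have hxy : x < y := lt_of_le_of_lt (hb hxK) (hKX' hy).2
    have hj0 : j ≠ 0 := by
      rintro rfl
      exact (hlt 0 i hi0 y hj x hi).not_gt hxy
    obtain ⟨k, rfl⟩ := Fin.exists_succ_eq.2 hj0
    exact Finset.mem_biUnion.2 ⟨k, Finset.mem_univ _, hj⟩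

theorem IsPrecompact.schreierSucc {G : Set (Finset ℕ+)} (hG : IsPrecompact G)
    (hher : IsHereditary G) : IsPrecompact (schreierSucc G) := by
  intro X hX
  obtain ⟨m, hm⟩ := hX.nonempty
  choose K hKX hK using fun n : ℕ => hG.exists_not_subset_biUnion hher n X hX
  -- The point `m` forces the number of blocks to be at most `m`, so finitely many witnesses
  -- suffice.
  refine ⟨insert m ((Finset.range (m + 1)).biUnion K), ?_, ?_⟩
  · intro x hx
    rcases Finset.mem_insert.1 (Finset.mem_coe.1 hx) with rfl | hx
    · exact hm
    · obtain ⟨n, -, hn⟩ := Finset.mem_biUnion.1 hx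
      exact hKX n hn
  · rintro ⟨n, F, hF, hn, hlt, h⟩
    obtain ⟨i, -, hi⟩ := Finset.mem_biUnion.1 (h ▸ Finset.mem_insert_self m _)
    have hnm : (n : ℕ) ≤ m := hn i m hi
    refine hK n F hF hlt fun x hx => h ▸ Finset.mem_insert_of_mem ?_
    exact Finset.mem_biUnion.2 ⟨n, Finset.mem_range.2 (Nat.lt_succ_of_le hnm), hx⟩

theorem isPrecompact_schreier {σ : Ordinal.{0} → ℕ+ → Ordinal.{0}} (hσ : IsLimitChoice σ)
    (ξ : Ordinal.{0}) (hξ : ξ < Ordinal.omega 1) : IsPrecompact (schreier σ ξ) := by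
  suffices h : IsHereditary (schreier σ ξ) ∧ IsPrecompact (schreier σ ξ) from h.2
  refine schreier_induction hσ (p := fun G => IsHereditary G ∧ IsPrecompact G) ?_
    (fun G hG => ⟨hG.1.schreierSucc, hG.2.schreierSucc hG.1⟩) ?_ ξ hξ
  · refine ⟨schreier_zero σ ▸ isHereditary_schreier hσ 0 (Ordinal.omega_pos 1), ?_⟩
    intro X hX
    obtain ⟨K, hKX, hK⟩ := hX.exists_subset_card_eq 2
    refine ⟨K, hKX, ?_⟩
    rintro (rfl | ⟨n, rfl⟩) <;> simp at hK
  · intro G hG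
    refine ⟨?_, ?_⟩
    · rintro s ⟨n, hs, hn⟩ t ht
      exact ⟨n, (hG n).1 s hs t ht, fun x hx => hn x (ht hx)⟩
    intro X hX
    obtain ⟨m, hm⟩ := hX.nonempty
    choose K hKX hK using fun n => (hG n).2 X hX
    refine ⟨insert m ((Finset.Iic m).biUnion K), ?_, ?_⟩
    · intro x hx
      rcases Finset.mem_insert.1 (Finset.mem_coe.1 hx) with rfl | hx
      · exact hm
      · obtain ⟨n, -, hn⟩ := Finset.mem_biUnion.1 hx
        exact hKX n hn
    · rintro ⟨n, hs, hn⟩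
      refine hK n ((hG n).1 _ hs _ fun x hx => Finset.mem_insert_of_mem ?_)
      exact Finset.mem_biUnion.2
        ⟨n, Finset.mem_Iic.2 (hn m (Finset.mem_insert_self _ _)), hx⟩

/-- `t` is a member of `T` obtained from `s` by adding one element above all those of `s`. -/
def IsExtension (T : Set (Finset ℕ+)) (t s : Finset ℕ+) : Prop :=
  t ∈ T ∧ ∃ n, (∀ x ∈ s, x < n) ∧ t = insert n s

/-- The union of an infinite branch would be an infinite set with all its finite subsets in `T`. -/
theorem IsPrecompact.wellFounded_isExtension {T : Set (Finset ℕ+)} (hT : IsPrecompact T)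
    (hher : IsHereditary T) : WellFounded (IsExtension T) := by
  rw [wellFounded_iff_isEmpty_descending_chain]
  refine ⟨fun ⟨f, hf⟩ => ?_⟩
  have hmono : Monotone f := monotone_nat_of_le_succ fun k => by
    obtain ⟨-, n, -, h⟩ := hf k
    rw [h]
    exact Finset.subset_insert _ _
  have hcard : ∀ k, k ≤ (f k).card := fun k => by
    induction k with
    | zero => exact Nat.zero_le _
    | succ k ih =>
      obtain ⟨-, n, hn, h⟩ := hf k
      rw [h, Finset.card_insert_of_notMem fun hmem => lt_irrefl n (hn n hmem)]
      exact Nat.succ_le_succ ih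
  obtain ⟨K, hKX, hK⟩ := hT (⋃ k, (f k : Set ℕ+)) fun hfin => by
    have h := Finset.card_le_card
      (show f (hfin.toFinset.card + 1) ⊆ hfin.toFinset from fun x hx =>
        hfin.mem_toFinset.2 (Set.mem_iUnion.2 ⟨_, hx⟩))
    have := hcard (hfin.toFinset.card + 1)
    omega
  choose! g hg using fun x (hx : x ∈ K) => Set.mem_iUnion.1 (hKX hx)
  refine hK (hher _ (hf (K.sup g)).1 _ fun x hx => ?_)
  exact hmono ((Finset.le_sup hx).trans (Nat.le_succ _)) (hg x hx)

/-! ### Diagonalization and the dichotomy -/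

/-- Diagonalization: a property `P n L` inherited by subsets of `L`, which can be achieved for
each `n` below any infinite set, can be achieved for all `n ∈ L` and `L ∩ (n, ∞)` at once. -/
theorem exists_infinite_forall_inter_Ioi {P : ℕ+ → Set ℕ+ → Prop}
    (hmono : ∀ n L L', L' ⊆ L → P n L → P n L')
    (hP : ∀ n M, M.Infinite → ∃ L ⊆ M, L.Infinite ∧ P n L) {M : Set ℕ+} (hM : M.Infinite) :
    ∃ L ⊆ M, L.Infinite ∧ ∀ n ∈ L, P n (L ∩ Set.Ioi n) := by
  have step : ∀ A : {A : Set ℕ+ // A.Infinite}, ∃ B : {B : Set ℕ+ // B.Infinite},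
      ∃ n ∈ A.1, B.1 ⊆ A.1 ∩ Set.Ioi n ∧ P n B.1 := fun A => by
    obtain ⟨n, hn⟩ := A.2.nonempty
    obtain ⟨B, hBA, hB, hPB⟩ := hP n _ (A.2.inter_Ioi n)
    exact ⟨⟨B, hB⟩, n, hn, hBA, hPB⟩
  choose next elt helt hnext hPnext using step
  let A : ℕ → {A : Set ℕ+ // A.Infinite} := fun k => next^[k] ⟨M, hM⟩
  have hA : ∀ k, A (k + 1) = next (A k) := fun k => Function.iterate_succ_apply' next k _
  have hanti : Antitone fun k => (A k).1 := antitone_nat_of_succ_le fun k => by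
    change (A (k + 1)).1 ⊆ (A k).1
    rw [hA]
    exact (hnext (A k)).trans Set.inter_subset_left
  have hlt : StrictMono fun k => elt (A k) := strictMono_nat_of_lt_succ fun k => by
    have h := helt (A (k + 1))
    rw [hA k] at h ⊢
    exact (hnext (A k) h).2
  refine ⟨Set.range fun k => elt (A k), ?_, Set.infinite_range_of_injective hlt.injective, ?_⟩
  · rintro _ ⟨k, rfl⟩
    exact hanti (Nat.zero_le k) (helt (A k))
  · rintro _ ⟨k, rfl⟩
    refine hmono _ _ _ ?_ (hPnext (A k))
    rintro _ ⟨⟨j, rfl⟩, hj⟩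
    rw [← hA k]
    exact hanti (Nat.succ_le_of_lt (hlt.lt_iff_lt.1 hj)) (helt (A j))

/-- Every member of `𝓐` which end-extends `s` by elements of `L` belongs to `𝓑`. -/
def ExtensionsSubset (𝓐 𝓑 : Set (Finset ℕ+)) (s : Finset ℕ+) (L : Set ℕ+) : Prop :=
  ∀ t : Finset ℕ+, (t : Set ℕ+) ⊆ L → (∀ x ∈ s, ∀ y ∈ t, x < y) → s ∪ t ∈ 𝓐 → s ∪ t ∈ 𝓑

theorem ExtensionsSubset.mono {𝓐 𝓑 : Set (Finset ℕ+)} {s : Finset ℕ+} {L L' : Set ℕ+}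
    (hL : L' ⊆ L) (h : ExtensionsSubset 𝓐 𝓑 s L) : ExtensionsSubset 𝓐 𝓑 s L' :=
  fun t ht => h t (ht.trans hL)

theorem ExtensionsSubset.of_insert {𝓐 𝓑 : Set (Finset ℕ+)} {s : Finset ℕ+} {L : Set ℕ+}
    (hs : s ∈ 𝓑) (h : ∀ n ∈ L, ExtensionsSubset 𝓐 𝓑 (insert n s) (L ∩ Set.Ioi n)) :
    ExtensionsSubset 𝓐 𝓑 s L := by
  intro t htL hst ht
  rcases t.eq_empty_or_nonempty with rfl | hne
  · simpa using hs
  have hm := t.min'_mem hne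
  have hlt : ∀ y ∈ t.erase (t.min' hne), t.min' hne < y := fun y hy =>
    t.min'_lt_of_mem_erase_min' hne hy
  have heq : insert (t.min' hne) s ∪ t.erase (t.min' hne) = s ∪ t := by
    rw [Finset.insert_union, ← Finset.union_insert, Finset.insert_erase hm]
  rw [← heq] at ht ⊢
  refine h _ (htL hm) _ (fun y hy => ⟨htL (Finset.mem_of_mem_erase hy), hlt y hy⟩) ?_ ht
  intro x hx y hy
  rcases Finset.mem_insert.1 hx with rfl | hx
  · exact hlt y hy
  · exact hst x hx y (Finset.mem_of_mem_erase hy)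

theorem exists_extensionsSubset {T 𝓕 : Set (Finset ℕ+)} (hT : IsHereditary T)
    (hwf : WellFounded (IsExtension T)) (h𝓕 : IsHereditary 𝓕) (s : Finset ℕ+) :
    ∀ M : Set ℕ+, M.Infinite → ∃ L ⊆ M, L.Infinite ∧
      (ExtensionsSubset T 𝓕 s L ∨ ExtensionsSubset 𝓕 T s L) := by
  induction s using hwf.induction with
  | _ s ih =>
  intro M hM
  obtain ⟨b, hb⟩ := s.bddAbove
  obtain ⟨L, hLM, hL, hdec⟩ := exists_infinite_forall_inter_Ioi
    (P := fun n L => (∀ x ∈ s, x < n) → insert n s ∈ T →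
      ExtensionsSubset T 𝓕 (insert n s) L ∨ ExtensionsSubset 𝓕 T (insert n s) L)
    (fun n L L' hL h hn hT => (h hn hT).imp (.mono hL) (.mono hL))
    (fun n M hM => by
      by_cases h : (∀ x ∈ s, x < n) ∧ insert n s ∈ T
      · obtain ⟨L, hLM, hL, h⟩ := ih _ ⟨h.2, n, h.1, rfl⟩ M hM
        exact ⟨L, hLM, hL, fun _ _ => h⟩
      · exact ⟨M, subset_rfl, hM, fun h1 h2 => (h ⟨h1, h2⟩).elim⟩)
    (hM.inter_Ioi b)
  have habove : ∀ n ∈ L, ∀ x ∈ s, x < n := fun n hn x hx =>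
    lt_of_le_of_lt (hb hx) (hLM hn).2
  have hcover : L = {n ∈ L | insert n s ∉ T} ∪
      ({n ∈ L | insert n s ∈ T ∧ ExtensionsSubset T 𝓕 (insert n s) (L ∩ Set.Ioi n)} ∪
       {n ∈ L | insert n s ∈ T ∧ ExtensionsSubset 𝓕 T (insert n s) (L ∩ Set.Ioi n)}) := by
    ext n
    have h := fun hn => hdec n hn (habove n hn)
    simp only [Set.mem_union, Set.mem_ofPred_eq]
    tauto
  have hLM' : L ⊆ M := hLM.trans Set.inter_subset_left
  have key := hL
  rw [hcover, Set.infinite_union, Set.infinite_union] at key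
  rcases key with hinf | hinf | hinf
  -- Here `s` has no proper end-extension in `T` along the new set, so membership of `s` in `𝓕`
  -- decides.
  · refine ⟨_, (Set.sep_subset _ _).trans hLM', hinf, ?_⟩
    by_cases hs : s ∈ 𝓕
    · left
      intro t htL _ ht
      rcases t.eq_empty_or_nonempty with rfl | ⟨m, hm⟩
      · simpa using hs
      · exact ((htL hm).2 (hT _ ht _ (Finset.insert_subset (Finset.mem_union_right _ hm)
          Finset.subset_union_left))).elim
    · right
      intro t _ _ ht
      exact (hs (h𝓕 _ ht _ Finset.subset_union_left)).elim
  · refine ⟨_, (Set.sep_subset _ _).trans hLM', hinf, Or.inl (.of_insert ?_ fun n hn => ?_)⟩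
    · obtain ⟨n, hn, hnT, h⟩ := hinf.nonempty
      -- The empty extension gives `insert n s ∈ 𝓕`, whence `s ∈ 𝓕` by heredity.
      have h := h ∅ (by simp) (by simp) (by simpa using hnT)
      exact h𝓕 _ h _ ((Finset.subset_insert _ _).trans Finset.subset_union_left)
    · exact hn.2.2.mono (Set.inter_subset_inter_left _ (Set.sep_subset _ _))
  · refine ⟨_, (Set.sep_subset _ _).trans hLM', hinf, Or.inr (.of_insert ?_ fun n hn => ?_)⟩
    · obtain ⟨n, hn, hnT, -⟩ := hinf.nonempty
      exact hT _ hnT _ (Finset.subset_insert _ _)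
    · exact hn.2.2.mono (Set.inter_subset_inter_left _ (Set.sep_subset _ _))

theorem mainTheorem7 (σ : Ordinal.{0} → ℕ+ → Ordinal.{0}) (hσ : IsLimitChoice σ)
    (𝓕 : Set (Finset ℕ+)) (h𝓕 : IsHereditary 𝓕)
    (ξ : Ordinal.{0}) (hξ : ξ < Ordinal.omega 1)
    (M : Set ℕ+) (hM : M.Infinite) :
    ∃ L : Set ℕ+, L.Infinite ∧ L ⊆ M ∧
      (transfer (schreier σ ξ) L ⊆ 𝓕 ∨ 𝓕 ∩ finiteSubsets L ⊆ schreier σ ξ) := by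
  have hher := isHereditary_schreier hσ ξ hξ
  obtain ⟨L, hLM, hL, h⟩ := exists_extensionsSubset hher
    ((isPrecompact_schreier hσ ξ hξ).wellFounded_isExtension hher) h𝓕 ∅ M hM
  refine ⟨L, hL, hLM, h.imp ?_ ?_⟩
  · rintro h _ ⟨ℓ, hℓ, rfl, t, ht, rfl⟩
    simpa using h (t.image ℓ) (by simp) (by simp)
      (by simpa using image_mem_schreier hσ hℓ ξ hξ t ht)
  · rintro h s ⟨hs, hsL⟩
    simpa using h s hsL (by simp) (by simpa using hs)
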